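/- All Banach spaces are complex. For Banach spaces $X,Y$, let $X\widehat\otimes Y$ be the projective tensor product, i.e. the completion of $X\otimes Y$ under $\|w\|=\inf\{\sum_k\|x_k\|\,\|y_k\|: w=\sum_{k=1}^N x_k\otimes y_k\}$. For $z\in X^*\widehat\otimes Y$ let $\widetilde z\in L(X,Y)$ be the associated nuclear operator (the continuous linear extension of $x'\otimes y\mapsto \langle x',\cdot\rangle y$), and let $\operatorname{trace}$ be the continuous linear extension of $x'\otimes x\mapsto\langle x',x\rangle$ to $X^*\widehat\otimes X$. A function $\alpha: E\to[0,+\infty]$ on a vector space is a quasinorm if $\alpha(x)=0$ implies $x=0$, $\alpha(ax)=|a|\alpha(x)$ for all scalars $a$ (with $0\cdot\infty=0$), and $\alpha(x+y)\le C[\alpha(x)+\alpha(y)]$ for some constant $C>0$. A projective tensor quasinorm is a function $\alpha$ with values in $[0,+\infty]$, defined on the elements of all projective tensor products $X\widehat\otimes Y$ of Banach spaces, which is a quasinorm on each $X\widehat\otimes Y$ with one constant $C$ common to all $X,Y$, and satisfies $\alpha(x\otimes y)=\|x\|\,\|y\|$ for $x\in X$, $y\in Y$, and $\alpha((A\otimes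 B)(u))\le\|A\|\,\alpha(u)\,\|B\|$ for all $u\in X\widehat\otimes Y$ and all bounded operators $A\in L(X,E)$, $B\in L(Y,F)$. Put $$X\widehat\otimes_\alpha Y=\{u\in X\widehat\otimes Y:\ \alpha(u)<\infty,\ \exists\,(u_n)\subset X\otimes Y:\ \alpha(u-u_n)\to0\}.$$ The quasinorm $\alpha$ is complete if, for all Banach spaces $X,Y$, every $\alpha$-Cauchy sequence in $X\widehat\otimes_\alpha Y$ $\alpha$-converges to an element of $X\widehat\otimes_\alpha Y$. A Banach space $X$ has the approximation property $AP_\alpha$ if for every Banach space $E$ the canonical map $u\mapsto\widetilde u$ from $E^*\widehat\otimes_\alpha X$ onto its image $N_\alpha(E,X)\subset L(E,X)$ is one-to-one. An operator $T\in L(X,X)$ is of spectral type $l_1$ if all its nonzero eigenvalues have finite algebraic multiplicity and no limit point except possibly $0$, and, repeated according to algebraic multiplicity, they form an absolutely summable family $(\lambda_k(T))$; its spectral trace is then $\operatorname{sp\,tr}(T)=\sum_k\lambda_k(T)$. **Proposition.** Let $\alpha$ be a complete projective tensor quasinorm and $X$ a Banach space. If for every $z\in X^*\widehat\otimes_\alpha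 X$ the operator $\widetilde z$ is of spectral type $l_1$ (so that its spectral trace is defined) and $\operatorname{trace} z=\operatorname{sp\,tr}\widetilde z$, then $X$ has the property $AP_\alpha$. -/

import Mathlib

open scoped TensorProduct ENNReal NNReal Topology

universe u

noncomputable section

/-! ### The projective tensor product of two normed spaces -/

section Projective

/-- The algebraic tensor product `X ⊗ Y`, to be normed by the projective norm. -/
def AlgTensor (X Y : Type*) [NormedAddCommGroup X] [NormedSpace ℂ X]
    [NormedAddCommGroup Y] [NormedSpace ℂ Y] : Type _ :=
  X ⊗[ℂ] Y

variable {X Y Z E F : Type*}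
  [NormedAddCommGroup X] [NormedSpace ℂ X] [NormedAddCommGroup Y] [NormedSpace ℂ Y]
  [NormedAddCommGroup Z] [NormedSpace ℂ Z] [CompleteSpace Z]
  [NormedAddCommGroup E] [NormedSpace ℂ E] [NormedAddCommGroup F] [NormedSpace ℂ F]

namespace AlgTensor

instance : AddCommGroup (AlgTensor X Y) := inferInstanceAs (AddCommGroup (X ⊗[ℂ] Y))

instance : Module ℂ (AlgTensor X Y) := inferInstanceAs (Module ℂ (X ⊗[ℂ] Y))

/-- The elementary tensor `x ⊗ y`. -/
def tmul (x : X) (y : Y) : AlgTensor X Y := x ⊗ₜ[ℂ] y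

/-- The numbers `∑ ‖x k‖ ‖y k‖`, over all finite representations `w = ∑ x k ⊗ y k`. -/
def reprSums (w : AlgTensor X Y) : Set ℝ :=
  {r | ∃ (n : ℕ) (x : Fin n → X) (y : Fin n → Y),
    w = ∑ k, tmul (x k) (y k) ∧ r = ∑ k, ‖x k‖ * ‖y k‖}

theorem reprSums_nonneg {w : AlgTensor X Y} {r : ℝ} (hr : r ∈ reprSums w) : 0 ≤ r := by
  obtain ⟨n, x, y, -, rfl⟩ := hr
  positivity

theorem reprSums_bddBelow (w : AlgTensor X Y) : BddBelow (reprSums w) :=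
  ⟨0, fun _ hr => reprSums_nonneg hr⟩

theorem reprSums_add {w w' : AlgTensor X Y} {r r' : ℝ} (hr : r ∈ reprSums w)
    (hr' : r' ∈ reprSums w') : r + r' ∈ reprSums (w + w') := by
  obtain ⟨n, x, y, rfl, rfl⟩ := hr
  obtain ⟨m, x', y', rfl, rfl⟩ := hr'
  refine ⟨n + m, Fin.append x x', Fin.append y y', ?_, ?_⟩ <;> simp [Fin.sum_univ_add]

theorem reprSums_smul (a : ℂ) {w : AlgTensor X Y} {r : ℝ} (hr : r ∈ reprSums w) :
    ‖a‖ * r ∈ reprSums (a • w) := by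
  obtain ⟨n, x, y, rfl, rfl⟩ := hr
  refine ⟨n, fun k => a • x k, y, ?_, ?_⟩
  · rw [Finset.smul_sum]; rfl
  · simp [Finset.mul_sum, norm_smul, mul_assoc]

theorem reprSums_tmul (x : X) (y : Y) : ‖x‖ * ‖y‖ ∈ reprSums (tmul x y) :=
  ⟨1, fun _ => x, fun _ => y, by simp, by simp⟩

theorem reprSums_nonempty (w : AlgTensor X Y) : (reprSums w).Nonempty := by
  refine TensorProduct.induction_on (motive := fun w => (reprSums (X := X) (Y := Y) w).Nonempty)
    w ?_ ?_ ?_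
  · exact ⟨0, 0, Fin.elim0, Fin.elim0, by simp; rfl, by simp⟩
  · exact fun x y => ⟨_, reprSums_tmul x y⟩
  · rintro w w' ⟨r, hr⟩ ⟨r', hr'⟩
    exact ⟨_, reprSums_add hr hr'⟩

/-- The projective norm: the infimum of `∑ ‖x k‖ ‖y k‖` over all finite representations
`w = ∑ x k ⊗ y k`. -/
def projSeminorm (X Y : Type*) [NormedAddCommGroup X] [NormedSpace ℂ X]
    [NormedAddCommGroup Y] [NormedSpace ℂ Y] : Seminorm ℂ (AlgTensor X Y) :=
  Seminorm.ofSMulLE (fun w => sInf (reprSums w))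
    (le_antisymm
      (csInf_le (reprSums_bddBelow _) ⟨0, Fin.elim0, Fin.elim0, by simp, by simp⟩)
      (le_csInf (reprSums_nonempty _) fun _ hr => reprSums_nonneg hr))
    (fun w w' => by
      rw [← csInf_add (reprSums_nonempty w) (reprSums_bddBelow w)
        (reprSums_nonempty w') (reprSums_bddBelow w')]
      refine csInf_le_csInf (reprSums_bddBelow _)
        ((reprSums_nonempty w).add (reprSums_nonempty w')) ?_
      rintro _ ⟨r, hr, r', hr', rfl⟩
      exact reprSums_add hr hr')
    (fun a w => by
      rw [← smul_eq_mul, ← Real.sInf_smul_of_nonneg (norm_nonneg a)]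
      refine csInf_le_csInf (reprSums_bddBelow _) (reprSums_nonempty w).smul_set ?_
      rintro _ ⟨r, hr, rfl⟩
      exact reprSums_smul a hr)

instance : SeminormedAddCommGroup (AlgTensor X Y) :=
  AddGroupSeminorm.toSeminormedAddCommGroup (projSeminorm X Y).toAddGroupSeminorm

theorem norm_def (w : AlgTensor X Y) : ‖w‖ = sInf (reprSums w) := rfl

instance : NormedSpace ℂ (AlgTensor X Y) :=
  ⟨fun a w => ((projSeminorm X Y).smul' a w).le⟩

/-- The linear map on `X ⊗ Y` induced by a bounded bilinear map. -/
def liftLinear (B : X →L[ℂ] Y →L[ℂ] F) : AlgTensor X Y →ₗ[ℂ] F :=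
  (TensorProduct.lift ((ContinuousLinearMap.coeLM ℂ).comp (B : X →ₗ[ℂ] Y →L[ℂ] F)) :
    X ⊗[ℂ] Y →ₗ[ℂ] F)

theorem liftLinear_tmul (B : X →L[ℂ] Y →L[ℂ] F) (x : X) (y : Y) :
    liftLinear B (tmul x y) = B x y :=
  TensorProduct.lift.tmul x y

theorem norm_liftLinear_le (B : X →L[ℂ] Y →L[ℂ] F) (w : AlgTensor X Y) :
    ‖liftLinear B w‖ ≤ ‖B‖ * ‖w‖ := by
  rw [norm_def, ← smul_eq_mul, ← Real.sInf_smul_of_nonneg (norm_nonneg B)]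
  refine le_csInf (reprSums_nonempty w).smul_set ?_
  rintro _ ⟨_, ⟨n, x, y, rfl, rfl⟩, rfl⟩
  simp only [smul_eq_mul, Finset.mul_sum, map_sum]
  refine (norm_sum_le _ _).trans (Finset.sum_le_sum fun k _ => ?_)
  rw [liftLinear_tmul, ← mul_assoc]
  exact B.le_opNorm₂ _ _

/-- The bounded linear map on `X ⊗ Y` induced by a bounded bilinear map. -/
def lift (B : X →L[ℂ] Y →L[ℂ] F) : AlgTensor X Y →L[ℂ] F :=
  (liftLinear B).mkContinuous ‖B‖ (norm_liftLinear_le B)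

@[simp]
theorem lift_tmul (B : X →L[ℂ] Y →L[ℂ] F) (x : X) (y : Y) : lift B (tmul x y) = B x y :=
  liftLinear_tmul B x y

end AlgTensor

/-- The projective tensor product `X ⊗̂ Y`: the completion of `X ⊗ Y` for the projective norm. -/
abbrev ProjTensor (X Y : Type*) [NormedAddCommGroup X] [NormedSpace ℂ X]
    [NormedAddCommGroup Y] [NormedSpace ℂ Y] : Type _ :=
  UniformSpace.Completion (AlgTensor X Y)

namespace ProjTensor

/-- The canonical map `X ⊗ Y → X ⊗̂ Y`. -/
def ofAlg : AlgTensor X Y →L[ℂ] ProjTensor X Y := UniformSpace.Completion.toComplL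

/-- The elementary tensor `x ⊗ y` in `X ⊗̂ Y`. -/
def tmul (x : X) (y : Y) : ProjTensor X Y := ofAlg (AlgTensor.tmul x y)

/-- The bounded operator on `X ⊗̂ Y` induced by a bounded bilinear map into a Banach space. -/
def lift (B : X →L[ℂ] Y →L[ℂ] Z) : ProjTensor X Y →L[ℂ] Z :=
  (AlgTensor.lift B).extend ofAlg

@[simp]
theorem lift_tmul (B : X →L[ℂ] Y →L[ℂ] Z) (x : X) (y : Y) : lift B (tmul x y) = B x y :=
  (ContinuousLinearMap.extend_eq _ UniformSpace.Completion.denseRange_coe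
    (UniformSpace.Completion.isUniformInducing_coe _) _).trans (AlgTensor.lift_tmul B x y)

/-- The canonical bounded bilinear map `(x, y) ↦ x ⊗ y`. -/
def tmulL : X →L[ℂ] Y →L[ℂ] ProjTensor X Y :=
  LinearMap.mkContinuous₂
    (LinearMap.mk₂ ℂ (fun x y => tmul x y)
      (fun x x' y => (congrArg ofAlg (TensorProduct.add_tmul x x' y)).trans (map_add ofAlg _ _))
      (fun a x y => (congrArg ofAlg (TensorProduct.smul_tmul' a x y).symm).trans
        (map_smul ofAlg a _))
      (fun x y y' => (congrArg ofAlg (TensorProduct.tmul_add x y y')).trans (map_add ofAlg _ _))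
      (fun a x y => (congrArg ofAlg (TensorProduct.tmul_smul a x y)).trans
        (map_smul ofAlg a _))) 1 (fun x y => by
      rw [one_mul]
      refine (UniformSpace.Completion.norm_coe (AlgTensor.tmul x y)).trans_le ?_
      exact csInf_le (AlgTensor.reprSums_bddBelow _) (AlgTensor.reprSums_tmul x y))

@[simp]
theorem tmulL_apply (x : X) (y : Y) : tmulL x y = tmul x y := rfl

/-- The operator `A ⊗ B : X ⊗̂ Y → E ⊗̂ F`. -/
def map (A : X →L[ℂ] E) (B : Y →L[ℂ] F) : ProjTensor X Y →L[ℂ] ProjTensor E F :=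
  lift (tmulL.bilinearComp A B)

@[simp]
theorem map_tmul (A : X →L[ℂ] E) (B : Y →L[ℂ] F) (x : X) (y : Y) :
    map A B (tmul x y) = tmul (A x) (B y) := by
  simp [map]

/-- The trace functional on `X* ⊗̂ X`, with `trace (x' ⊗ x) = x' x`. -/
def trace (X : Type*) [NormedAddCommGroup X] [NormedSpace ℂ X] :
    ProjTensor (StrongDual ℂ X) X →L[ℂ] ℂ :=
  lift (ContinuousLinearMap.id ℂ (StrongDual ℂ X))

@[simp]
theorem trace_tmul (x' : StrongDual ℂ X) (x : X) : trace X (tmul x' x) = x' x := by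
  simp [trace]

/-- The canonical map `u ↦ ũ` from `E* ⊗̂ Z` to `L(E, Z)`: the tensor `e' ⊗ z` goes to the
operator `e ↦ e' e • z`. -/
def toOperator (E Z : Type*) [NormedAddCommGroup E] [NormedSpace ℂ E]
    [NormedAddCommGroup Z] [NormedSpace ℂ Z] [CompleteSpace Z] :
    ProjTensor (StrongDual ℂ E) Z →L[ℂ] (E →L[ℂ] Z) :=
  lift (ContinuousLinearMap.smulRightL ℂ E Z)

@[simp]
theorem toOperator_tmul (e' : StrongDual ℂ E) (z : Z) (e : E) :
    toOperator E Z (tmul e' z) e = e' e • z := by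
  simp [toOperator]

end ProjTensor

end Projective

/-! ### Projective tensor quasinorms -/

/-- A quasinorm on a vector space; it may take the value `∞`. -/
structure IsQuasinorm {V : Type*} [AddCommGroup V] [Module ℂ V] (α : V → ℝ≥0∞) : Prop where
  eq_zero : ∀ v, α v = 0 → v = 0
  add_le : ∃ C : ℝ≥0, 0 < C ∧ ∀ v w, α (v + w) ≤ C * (α v + α w)
  smul : ∀ (a : ℂ) (v : V), α (a • v) = ‖a‖ₑ * α v

/-- A projective tensor quasinorm: a function on the elements of all projective tensor products
`X ⊗̂ Y` of Banach spaces. The density of `X ⊗ Y` in the `α`-projective tensor product is part of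
the definition of the latter, see `ProjTensorQuasinorm.tensor` and
`ProjTensorQuasinorm.exists_ofAlg_tendsto` below. -/
structure ProjTensorQuasinorm where
  /-- The underlying function. -/
  toFun : ∀ (X Y : Type u) [NormedAddCommGroup X] [NormedSpace ℂ X] [CompleteSpace X]
    [NormedAddCommGroup Y] [NormedSpace ℂ Y] [CompleteSpace Y], ProjTensor X Y → ℝ≥0∞
  isQuasinorm : ∀ (X Y : Type u) [NormedAddCommGroup X] [NormedSpace ℂ X] [CompleteSpace X]
    [NormedAddCommGroup Y] [NormedSpace ℂ Y] [CompleteSpace Y], IsQuasinorm (toFun X Y)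
  tmul : ∀ (X Y : Type u) [NormedAddCommGroup X] [NormedSpace ℂ X] [CompleteSpace X]
    [NormedAddCommGroup Y] [NormedSpace ℂ Y] [CompleteSpace Y] (x : X) (y : Y),
    toFun X Y (ProjTensor.tmul x y) = ‖x‖ₑ * ‖y‖ₑ
  add_le : ∃ C : ℝ≥0, 0 < C ∧
    ∀ (X Y : Type u) [NormedAddCommGroup X] [NormedSpace ℂ X] [CompleteSpace X]
      [NormedAddCommGroup Y] [NormedSpace ℂ Y] [CompleteSpace Y] (u₁ u₂ : ProjTensor X Y),
      toFun X Y (u₁ + u₂) ≤ C * (toFun X Y u₁ + toFun X Y u₂)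
  map_le : ∀ (X Y E F : Type u) [NormedAddCommGroup X] [NormedSpace ℂ X] [CompleteSpace X]
    [NormedAddCommGroup Y] [NormedSpace ℂ Y] [CompleteSpace Y]
    [NormedAddCommGroup E] [NormedSpace ℂ E] [CompleteSpace E]
    [NormedAddCommGroup F] [NormedSpace ℂ F] [CompleteSpace F]
    (A : X →L[ℂ] E) (B : Y →L[ℂ] F) (w : ProjTensor X Y),
    toFun E F (ProjTensor.map A B w) ≤ ‖A‖ₑ * toFun X Y w * ‖B‖ₑ

namespace ProjTensorQuasinorm

variable (α : ProjTensorQuasinorm.{u})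

section

variable (X Y : Type u) [NormedAddCommGroup X] [NormedSpace ℂ X] [CompleteSpace X]
  [NormedAddCommGroup Y] [NormedSpace ℂ Y] [CompleteSpace Y]

theorem toFun_zero : α.toFun X Y 0 = 0 := by
  simpa using (α.isQuasinorm X Y).smul 0 0

/-- The `α`-projective tensor product `X ⊗̂_α Y`: the tensors `w` in `X ⊗̂ Y` with `α w < ∞` that
are `α`-limits of sequences of elements of the algebraic tensor product `X ⊗ Y`. -/
def tensor : Submodule ℂ (ProjTensor X Y) where
  carrier := {w | α.toFun X Y w < ∞ ∧ ∃ s : ℕ → AlgTensor X Y,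
    Filter.Tendsto (fun n => α.toFun X Y (w - ProjTensor.ofAlg (s n))) Filter.atTop (𝓝 0)}
  zero_mem' := ⟨by simp [toFun_zero], fun _ => 0, by simp [toFun_zero]⟩
  add_mem' := by
    rintro v w ⟨hv, s, hs⟩ ⟨hw, t, ht⟩
    obtain ⟨C, -, hC⟩ := (α.isQuasinorm X Y).add_le
    refine ⟨(hC v w).trans_lt (ENNReal.mul_lt_top ENNReal.coe_lt_top
      (ENNReal.add_lt_top.2 ⟨hv, hw⟩)), s + t, ?_⟩
    have h := ENNReal.Tendsto.const_mul (a := (C : ℝ≥0∞)) (hs.add ht)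
      (Or.inr ENNReal.coe_ne_top)
    rw [add_zero, mul_zero] at h
    refine tendsto_of_tendsto_of_tendsto_of_le_of_le tendsto_const_nhds h
      (fun _ => zero_le) fun n => ?_
    have e : v + w - ProjTensor.ofAlg ((s + t) n) =
        (v - ProjTensor.ofAlg (s n)) + (w - ProjTensor.ofAlg (t n)) := by
      simp only [Pi.add_apply, map_add]; abel
    simpa only [e] using hC _ _
  smul_mem' := by
    rintro a w ⟨hw, s, hs⟩
    refine ⟨?_, fun n => a • s n, ?_⟩
    · rw [(α.isQuasinorm X Y).smul]
      exact ENNReal.mul_lt_top (by simp) hw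
    · have h := ENNReal.Tendsto.const_mul (a := ‖a‖ₑ) hs (Or.inr (by simp))
      rw [mul_zero] at h
      refine h.congr fun n => ?_
      rw [← (α.isQuasinorm X Y).smul, smul_sub, map_smul]

/-- The algebraic tensor product is contained in `X ⊗̂_α Y`. -/
theorem ofAlg_mem_tensor (w : AlgTensor X Y) : ProjTensor.ofAlg w ∈ α.tensor X Y := by
  refine TensorProduct.induction_on
    (motive := fun w => ProjTensor.ofAlg (X := X) (Y := Y) w ∈ α.tensor X Y) w ?_ ?_ ?_
  · exact (map_zero (ProjTensor.ofAlg (X := X) (Y := Y))).symm ▸ (α.tensor X Y).zero_mem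
  · intro x y
    refine ⟨?_, fun _ => AlgTensor.tmul x y, ?_⟩
    · exact (α.tmul X Y x y).trans_lt (ENNReal.mul_lt_top (by simp) (by simp))
    · change Filter.Tendsto (fun _ => α.toFun X Y (ProjTensor.ofAlg (AlgTensor.tmul x y) -
        ProjTensor.ofAlg (AlgTensor.tmul x y))) _ _
      simp [toFun_zero]
  · intro v w hv hw
    exact (map_add (ProjTensor.ofAlg (X := X) (Y := Y)) v w).symm ▸ (α.tensor X Y).add_mem hv hw

/-- The algebraic tensor product is `α`-dense in `X ⊗̂_α Y`. -/
theorem exists_ofAlg_tendsto {w : ProjTensor X Y} (hw : w ∈ α.tensor X Y) :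
    ∃ s : ℕ → AlgTensor X Y,
      Filter.Tendsto (fun n => α.toFun X Y (w - ProjTensor.ofAlg (s n))) Filter.atTop (𝓝 0) :=
  hw.2

/-- The canonical map `X* ⊗̂_α Y → L(X, Y)`, `w ↦ w̃`. -/
def canonicalMap : α.tensor (StrongDual ℂ X) Y →ₗ[ℂ] (X →L[ℂ] Y) :=
  (ProjTensor.toOperator X Y : ProjTensor (StrongDual ℂ X) Y →ₗ[ℂ] (X →L[ℂ] Y)).domRestrict
    (α.tensor (StrongDual ℂ X) Y)

/-- The space `N_α(X, Y)` of `α`-nuclear operators: the image of the canonical map. -/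
def nuclear : Submodule ℂ (X →L[ℂ] Y) := LinearMap.range (α.canonicalMap X Y)

end

/-- `α` is complete: in every `X ⊗̂_α Y`, every `α`-Cauchy sequence `α`-converges to an element of
`X ⊗̂_α Y`. -/
def Complete : Prop :=
  ∀ (X Y : Type u) [NormedAddCommGroup X] [NormedSpace ℂ X] [CompleteSpace X]
    [NormedAddCommGroup Y] [NormedSpace ℂ Y] [CompleteSpace Y] (s : ℕ → ProjTensor X Y),
    (∀ n, s n ∈ α.tensor X Y) →
    (∀ ε : ℝ≥0∞, 0 < ε → ∃ N, ∀ m ≥ N, ∀ n ≥ N, α.toFun X Y (s m - s n) < ε) →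
    ∃ w ∈ α.tensor X Y, Filter.Tendsto (fun n => α.toFun X Y (s n - w)) Filter.atTop (𝓝 0)

/-- The approximation property `AP_α`: for every Banach space `E`, the canonical map
`E* ⊗̂_α X → N_α(E, X)` is one-to-one. -/
def HasAP (X : Type u) [NormedAddCommGroup X] [NormedSpace ℂ X] [CompleteSpace X] : Prop :=
  ∀ (E : Type u) [NormedAddCommGroup E] [NormedSpace ℂ E] [CompleteSpace E],
    Function.Injective
      ((α.canonicalMap E X).rangeRestrict : α.tensor (StrongDual ℂ E) X →ₗ[ℂ] α.nuclear E X)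

end ProjTensorQuasinorm

/-! ### The spectral trace -/

section Spectral

variable {X : Type*} [NormedAddCommGroup X] [NormedSpace ℂ X]

/-- The set of nonzero eigenvalues of `T`. -/
def nonzeroEigenvalues (T : X →L[ℂ] X) : Set ℂ :=
  {μ | μ ≠ 0 ∧ Module.End.HasEigenvalue (T : Module.End ℂ X) μ}

/-- The algebraic multiplicity of `μ`: the dimension of `⋃ₖ ker (T - μ)ᵏ`
(meaningful when this space is finite-dimensional). -/
def algMultiplicity (T : X →L[ℂ] X) (μ : ℂ) : ℕ :=
  Module.finrank ℂ (Module.End.maxGenEigenspace (T : Module.End ℂ X) μ)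

/-- The index set of the family `λ(T)` of nonzero eigenvalues of `T`, each of them
repeated according to its algebraic multiplicity. -/
abbrev EigenIndex (T : X →L[ℂ] X) : Type :=
  Σ μ : nonzeroEigenvalues T, Fin (algMultiplicity T (μ : ℂ))

/-- `T` has spectral type `l₁`: its nonzero eigenvalues have finite algebraic multiplicity and no
limit point other than possibly `0`, and their family `λ(T)`, counted with algebraic multiplicity,
is absolutely summable. -/
structure HasSpectralTypeL1 (T : X →L[ℂ] X) : Prop where
  finite_multiplicity : ∀ μ ∈ nonzeroEigenvalues T,
    FiniteDimensional ℂ (Module.End.maxGenEigenspace (T : Module.End ℂ X) μ)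
  no_limit_point : ∀ μ : ℂ, μ ≠ 0 → ¬ AccPt μ (Filter.principal (nonzeroEigenvalues T))
  summable : Summable fun i : EigenIndex T => ‖(i.1 : ℂ)‖

/-- The spectral trace of an operator of spectral type `l₁`: the sum of its nonzero eigenvalues,
counted with algebraic multiplicity. -/
def spectralTrace (T : X →L[ℂ] X) : ℂ := ∑' i : EigenIndex T, (i.1 : ℂ)

end Spectral

end

/-! The argument is trace duality. Let `w` in `E* ⊗̂_α X` induce the zero operator; since bounded
functionals separate the points of `E* ⊗̂ X`, it suffices that `f w = 0` for each such functional
`f`. Now `f` corresponds to an operator `A : E* → X*`, `A e' = f (e' ⊗ ·)`, and `f w` is the trace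
of `z = (A ⊗ id) w` (`trace_map_dualOperator`). The tensor `z` lies in `X* ⊗̂_α X` by the ideal
property of `α` (`map_mem_tensor`), and `z̃ = 0` (`toOperator_map_eq_zero`). The trace formula for
`z` then gives `f w = trace z = sp tr 0 = 0`.

The delicate point is `z̃ = 0`: `A` need not be the adjoint of an operator `X → E`, so `z̃` need not
factor through `w̃`. Instead, `z̃` is tested against functionals on `X`, which brings in the adjoint
of `w̃`. -/

namespace ProjTensor

section

variable {X Y Z E F : Type*}
  [NormedAddCommGroup X] [NormedSpace ℂ X] [NormedAddCommGroup Y] [NormedSpace ℂ Y]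
  [NormedAddCommGroup Z] [NormedSpace ℂ Z]
  [NormedAddCommGroup E] [NormedSpace ℂ E] [NormedAddCommGroup F] [NormedSpace ℂ F]

/-- Bounded operators on `X ⊗̂ Y` agreeing on elementary tensors are equal. -/
theorem clm_ext {f g : ProjTensor X Y →L[ℂ] Z} (h : ∀ x y, f (tmul x y) = g (tmul x y)) :
    f = g := by
  have key : ∀ w : AlgTensor X Y, f (ofAlg w) = g (ofAlg w) := fun w => by
    refine TensorProduct.induction_on
      (motive := fun w => f (ofAlg (X := X) (Y := Y) w) = g (ofAlg w)) w ?_ h ?_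
    · exact (map_zero (f.comp (ofAlg (X := X) (Y := Y)))).trans
        (map_zero (g.comp (ofAlg (X := X) (Y := Y)))).symm
    · intro v w hv hw
      exact (map_add (f.comp (ofAlg (X := X) (Y := Y))) v w).trans
        ((congrArg₂ (· + ·) hv hw).trans (map_add (g.comp (ofAlg (X := X) (Y := Y))) v w).symm)
  ext w
  -- The algebraic tensors are dense, so agreement there passes to the completion by continuity.
  exact congrFun (UniformSpace.Completion.ext f.continuous g.continuous key) w

/-- The operator `A ⊗ B` maps the algebraic tensor product into the algebraic tensor product. -/
theorem exists_map_ofAlg (A : X →L[ℂ] E) (B : Y →L[ℂ] F) (w : AlgTensor X Y) :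
    ∃ w' : AlgTensor E F, map A B (ofAlg w) = ofAlg w' := by
  refine TensorProduct.induction_on
    (motive := fun w => ∃ w', map A B (ofAlg (X := X) (Y := Y) w) = ofAlg w') w ?_ ?_ ?_
  · exact ⟨0, (map_zero ((map A B).comp (ofAlg (X := X) (Y := Y)))).trans (map_zero ofAlg).symm⟩
  · exact fun x y => ⟨AlgTensor.tmul (A x) (B y), map_tmul A B x y⟩
  · rintro v w ⟨v', hv⟩ ⟨w', hw⟩
    exact ⟨v' + w', (map_add ((map A B).comp (ofAlg (X := X) (Y := Y))) v w).trans
      ((congrArg₂ (· + ·) hv hw).trans (map_add ofAlg v' w').symm)⟩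

/-- The operator `X → Y*` associated with a bounded functional on `X ⊗̂ Y`. -/
noncomputable def dualOperator (f : StrongDual ℂ (ProjTensor X Y)) : X →L[ℂ] StrongDual ℂ Y :=
  (ContinuousLinearMap.compL ℂ Y (ProjTensor X Y) ℂ f).comp tmulL

@[simp]
theorem dualOperator_apply (f : StrongDual ℂ (ProjTensor X Y)) (x : X) (y : Y) :
    dualOperator f x y = f (tmul x y) := rfl

/-- Trace duality: every functional on `X ⊗̂ Y` is a trace. -/
theorem trace_map_dualOperator (f : StrongDual ℂ (ProjTensor X Y)) (w : ProjTensor X Y) :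
    trace Y (map (dualOperator f) (ContinuousLinearMap.id ℂ Y) w) = f w := by
  have h : (trace Y).comp (map (dualOperator f) (ContinuousLinearMap.id ℂ Y)) = f :=
    clm_ext fun x y => by simp
  exact congrArg (fun g : StrongDual ℂ (ProjTensor X Y) => g w) h

/-- If the nuclear operator `w̃ : E → Y` vanishes, so does the one associated with
`(A ⊗ id) w`. -/
theorem toOperator_map_eq_zero [CompleteSpace Y] (A : StrongDual ℂ E →L[ℂ] StrongDual ℂ X)
    {w : ProjTensor (StrongDual ℂ E) Y} (hw : toOperator E Y w = 0) :
    toOperator X Y (map A (ContinuousLinearMap.id ℂ Y) w) = 0 := by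
  ext x
  refine SeparatingDual.eq_zero_of_forall_dual_eq_zero (R := ℂ) fun y' => ?_
  -- With `z = (A ⊗ id) w`, this is the identity `y' (z̃ x) = A (y' ∘ w̃) x`. Both sides are
  -- continuous and linear in `w`, and at `w = e' ⊗ y` both equal `A e' x * y' y`. The right side
  -- depends on `w` only through `w̃`, hence vanishes with it.
  have h : (y'.comp (ContinuousLinearMap.apply ℂ Y x)).comp ((toOperator X Y).comp
      (map A (ContinuousLinearMap.id ℂ Y))) =
      (A.flip x).comp ((ContinuousLinearMap.compL ℂ E Y ℂ y').comp (toOperator E Y)) :=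
    clm_ext fun e' y => by
      have e : y'.comp (toOperator E Y (tmul e' y)) = y' y • e' := by
        ext e
        simp [mul_comm]
      simp [e, mul_comm]
  have h' := congrArg (fun g : StrongDual ℂ (ProjTensor (StrongDual ℂ E) Y) => g w) h
  simpa [hw] using h'

end

end ProjTensor

/-- The ideal inequality does both jobs: applied to `w` it keeps `α` finite, and applied to the
errors `w - s n` it shows that the images of the approximating algebraic tensors, again algebraic,
converge to the image of `w`. -/
theorem ProjTensorQuasinorm.map_mem_tensor (α : ProjTensorQuasinorm.{u}) {X Y E F : Type u}
    [NormedAddCommGroup X] [NormedSpace ℂ X] [CompleteSpace X]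
    [NormedAddCommGroup Y] [NormedSpace ℂ Y] [CompleteSpace Y]
    [NormedAddCommGroup E] [NormedSpace ℂ E] [CompleteSpace E]
    [NormedAddCommGroup F] [NormedSpace ℂ F] [CompleteSpace F]
    (A : X →L[ℂ] E) (B : Y →L[ℂ] F) {w : ProjTensor X Y} (hw : w ∈ α.tensor X Y) :
    ProjTensor.map A B w ∈ α.tensor E F := by
  obtain ⟨hfin, s, hs⟩ := hw
  choose t ht using fun n => ProjTensor.exists_map_ofAlg A B (s n)
  refine ⟨(α.map_le X Y E F A B w).trans_lt
    (ENNReal.mul_lt_top (ENNReal.mul_lt_top (by simp) hfin) (by simp)), t, ?_⟩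
  have h := ENNReal.Tendsto.mul_const (b := ‖B‖ₑ)
    (ENNReal.Tendsto.const_mul (a := ‖A‖ₑ) hs (Or.inr (by simp))) (Or.inr (by simp))
  rw [mul_zero, zero_mul] at h
  refine tendsto_of_tendsto_of_tendsto_of_le_of_le tendsto_const_nhds h
    (fun _ => zero_le) fun n => ?_
  simp only [← ht, ← map_sub]
  exact α.map_le X Y E F A B _

/-- The zero operator has no nonzero eigenvalue, so the sum is over an empty index set. -/
theorem spectralTrace_zero {X : Type*} [NormedAddCommGroup X] [NormedSpace ℂ X] :
    spectralTrace (0 : X →L[ℂ] X) = 0 := by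
  have : IsEmpty (EigenIndex (0 : X →L[ℂ] X)) := by
    refine ⟨fun i => ?_⟩
    obtain ⟨hμ, hev⟩ := i.1.2
    obtain ⟨x, hx⟩ := hev.exists_hasEigenvector
    have h : (0 : X) = (i.1 : ℂ) • x := hx.apply_eq_smul
    exact (smul_ne_zero hμ hx.2) h.symm
  exact tsum_empty

theorem mainTheorem12 (α : ProjTensorQuasinorm.{u}) (hα : α.Complete)
    (X : Type u) [NormedAddCommGroup X] [NormedSpace ℂ X] [CompleteSpace X]
    (h : ∀ z ∈ α.tensor (StrongDual ℂ X) X,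
      HasSpectralTypeL1 (ProjTensor.toOperator X X z) ∧
        ProjTensor.trace X z = spectralTrace (ProjTensor.toOperator X X z)) :
    α.HasAP X := by
  intro E _ _ _
  rw [injective_iff_map_eq_zero]
  rintro ⟨w, hw⟩ h0
  have hop : ProjTensor.toOperator E X w = 0 := congrArg Subtype.val h0
  -- Hahn–Banach is used in the full projective tensor product, whose norm is a genuine one; the
  -- quasinorm `α` may have too few continuous functionals.
  refine Subtype.ext (SeparatingDual.eq_zero_of_forall_dual_eq_zero (R := ℂ) fun f => ?_)
  have htr := (h _ (α.map_mem_tensor (ProjTensor.dualOperator f)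
    (ContinuousLinearMap.id ℂ X) hw)).2
  rwa [ProjTensor.trace_map_dualOperator, ProjTensor.toOperator_map_eq_zero _ hop,
    spectralTrace_zero] at htr
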